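/- **Setting.** Let $A$ be a set of actions containing a distinguished action $\surd$ (successful termination). A *signature* is a set of operators with ranks; *processes* are its closed terms, forming the set $\mathsf T$; $\Delta(\mathsf T)$ is the set of discrete probability distributions on $\mathsf T$, $\delta(t)$ is the Dirac distribution at $t$, $\theta\oplus_p\eta=p\,\theta+(1-p)\,\eta$, and $f(\pi_1,\dots,\pi_n)$ is the image of the product distribution under $(t_1,\dots,t_n)\mapsto f(t_1,\dots,t_n)$. A *PGSOS rule* derives a transition $f(x_1,\dots,x_n)\xrightarrow{a}\theta$ from finitely many premises $x_i\xrightarrow{b}\mu$ (with pairwise distinct distribution variables $\mu$) and $x_i\stackrel{b}{\nrightarrow}$ (no $b$-transition), where $\theta$ is built from these $x_i$ and $\mu$ by Dirac distributions of terms, convex combinations with positive weights and operators. A *specification* is a signature with a set of PGSOS rules, finitely many for each operator and label of the conclusion; its *supported model* is the unique relation ${\to}\subseteq\mathsf T\times A\times\Delta(\mathsf T)$ consisting exactly of the conclusions of those rule instances whose premises hold in it. A specification $P$ is a *disjoint extension* of $Q$ if it contains the operators and rules of $Q$ and has no other rules for the operators of $Q$. The process algebra $P_{\mathrm{PA}^\circlearrowleft}$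 has the following operators and rules, where $a\in A$ and $p\in(0,1)$ are arbitrary: * $0$: no rule; $\varepsilon\xrightarrow{\surd}\delta(0)$; $a.\bigoplus_{i=1}^n[p_i]x_i\xrightarrow{a}\sum_i p_i\delta(x_i)$ for $n\ge1$, $p_i\in(0,1]$, $\sum_ip_i=1$ (and $a.x$ stands for $a.([1]x)$); * $x;y\xrightarrow{a}\mu;\delta(y)$ if $x\xrightarrow{a}\mu$, $a\ne\surd$; $x;y\xrightarrow{a}\nu$ if $x\xrightarrow{\surd}\mu$, $y\xrightarrow{a}\nu$; * $x+y\xrightarrow{a}\mu$ if $x\xrightarrow{a}\mu$ or $y\xrightarrow{a}\mu$; $x+_py\xrightarrow{a}\mu\oplus_p\nu$ if $x\xrightarrow{a}\mu$, $y\xrightarrow{a}\nu$, and $x+_py\xrightarrow{a}\mu$ if one of $x,y$ has the transition $\xrightarrow{a}\mu$ and the other has no $a$-transition; * $x\mid y\xrightarrow{a}\mu\mid\nu$ if $x\xrightarrow{a}\mu$, $y\xrightarrow{a}\nu$, $a\neq\surd$; for each of the compositions $\mathbin{\circ}\in\{\mid,\;|||,\;|||_p,\;\parallel_B\}$: $x\circ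 y\xrightarrow{\surd}\delta(0)$ if $x\xrightarrow{\surd}\mu$, $y\xrightarrow{\surd}\nu$; * for $a\ne\surd$: $x\,|||\,y\xrightarrow{a}\mu\,|||\,\delta(y)$ if $x\xrightarrow{a}\mu$; $x\,|||\,y\xrightarrow{a}\delta(x)\,|||\,\nu$ if $y\xrightarrow{a}\nu$; $x\,|||_p\,y$ has these two rules (with $|||_p$ in the targets) with the extra premise that the other argument has no $a$-transition, and $x\,|||_p\,y\xrightarrow{a}(\mu\,|||_p\,\delta(y))\oplus_p(\delta(x)\,|||_p\,\nu)$ if $x\xrightarrow{a}\mu$, $y\xrightarrow{a}\nu$; for $B\subseteq A$, $x\parallel_By$ has (with $\parallel_B$ in the targets) the rules of $|||$ for $a\notin B$ and that of $\mid$ for $a\in B$; * $x^0\xrightarrow{\surd}\delta(0)$; $x^{n+1}\xrightarrow{\surd}\mu$ if $x\xrightarrow{\surd}\mu$; for $a\ne\surd$: $x^{n+1}\xrightarrow{a}\mu;\delta(x^n)$ if $x\xrightarrow{a}\mu$, and $x^n\xrightarrow{a}\nu;\delta(x^m)$ if $m<n$, $x\xrightarrow{\surd}\mu$, $x\xrightarrow{a}\nu$;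 * infinite iteration: $x^\omega\xrightarrow{a}\mu;\delta(x^\omega)$ if $x\xrightarrow{a}\mu$, $a\neq\surd$; * Kleene star: $x^*y\xrightarrow{a}\mu;\delta(x^*y)$ if $x\xrightarrow{a}\mu$, $a\ne\surd$; $x^*y\xrightarrow{a}\nu$ if $y\xrightarrow{a}\nu$; * probabilistic Kleene star, for $a\neq\surd$: $x^{*_p}y\xrightarrow{a}\nu\oplus_p(\mu;\delta(x^{*_p}y))$ if $x\xrightarrow{a}\mu$, $y\xrightarrow{a}\nu$; $x^{*_p}y\xrightarrow{a}\mu;\delta(x^{*_p}y)$ if $x\xrightarrow{a}\mu$, $y\stackrel{a}{\nrightarrow}$; $x^{*_p}y\xrightarrow{a}\nu$ if $x\stackrel{a}{\nrightarrow}$, $y\xrightarrow{a}\nu$; and $x^{*_p}y\xrightarrow{\surd}\nu$ if $y\xrightarrow{\surd}\nu$; * $!^0x\xrightarrow{\surd}\delta(0)$; $!^{n+1}x\xrightarrow{\surd}\mu$ if $x\xrightarrow{\surd}\mu$; $!^{n+1}x\xrightarrow{a}\mu\,|||\,\delta(!^nx)$ if $x\xrightarrow{a}\mu$, $a\ne\surd$;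 * bang: $!x\xrightarrow{a}\mu\,|||\,\delta(!x)$ if $x\xrightarrow{a}\mu$, $a\neq\surd$; probabilistic bang: $!_px\xrightarrow{a}\mu\oplus_p(\mu\,|||\,\delta(!_px))$ if $x\xrightarrow{a}\mu$, $a\ne\surd$. A pseudometric $d:\mathsf T\times\mathsf T\to[0,1]$ is a *non-discounted bisimulation metric* if, whenever $d(t,t')<1$ and $t\xrightarrow{a}\pi$, there is $t'\xrightarrow{a}\pi'$ with $\mathbf K(d)(\pi,\pi')\le d(t,t')$, where $\mathbf K(d)(\pi,\pi')=\min_\omega\sum_{u,u'}d(u,u')\,\omega(u,u')$ over all distributions $\omega$ on $\mathsf T\times\mathsf T$ with marginals $\pi,\pi'$. The *non-discounted bisimilarity metric* $\mathbf d$ (discount factor $\lambda=1$) is the smallest one, i.e. the pointwise infimum of all of them. An $n$-ary operator $f$ is *uniformly continuous* w.r.t. $\mathbf d$ if for every $\epsilon>0$ there are $\delta_1,\dots,\delta_n>0$ such that for all processes $s_i,t_i$: if $\mathbf d(s_i,t_i)<\delta_i$ for all $i$, then $\mathbf d(f(s_1,\dots,s_n),f(t_1,\dots,t_n))<\epsilon$.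 **Proposition.** Let $P$ be any disjoint extension of $P_{\mathrm{PA}^\circlearrowleft}$, let $\mathbf d$ be the non-discounted bisimilarity metric of its supported model, and let $a\in A$ with $a\neq\surd$. 1. None of infinite iteration $\_^\omega$, Kleene star $\_^*\_$ and probabilistic Kleene star $\_^{*_p}\_$ (for any $p\in(0,1)$) is uniformly continuous w.r.t. $\mathbf d$. 2. If $A$ contains a further action $b\notin\{a,\surd\}$, then bang $!\_$ is not uniformly continuous w.r.t. $\mathbf d$. 3. For every $\delta\in(0,2)$, the processes $s=a.([1-\delta/2]\varepsilon\oplus[\delta/2]0)$ and $t=a.\varepsilon$ satisfy $\mathbf d(s,t)=\delta/2$ and $\mathbf d(s^\omega,t^\omega)=1$. -/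

import Mathlib

namespace ProbProc

universe u v w

/-! ### Signatures, terms, distributions -/

/-- A signature: `Op n` is the set of operators of rank `n`. -/
structure Signature where
  Op : ℕ → Type u

/-- State terms over the signature `S` and the set `V` of state variables. -/
inductive Term (S : Signature.{u}) (V : Type) : Type u
  | var (x : V) : Term S V
  | op {n : ℕ} (f : S.Op n) (ts : Fin n → Term S V) : Term S V

/-- Closed state terms, i.e. processes. -/
abbrev Proc (S : Signature.{u}) : Type u := Term S Empty

/-- Substitution of state terms for state variables. -/
def Term.subst {S : Signature.{u}} {V W : Type} (σ : V → Term S W) : Term S V → Term S W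
  | .var x => σ x
  | .op f ts => .op f (fun i => (ts i).subst σ)

/-- Distribution terms over `S`, state variables `Vs` and distribution variables `Vd`:
distribution variables, instantiable Dirac distributions, convex combinations (with positive
weights, so that the index set is countable) and lifted operators. -/
inductive DTerm (S : Signature.{u}) (Vs Vd : Type) : Type (max u 1)
  | var (μ : Vd) : DTerm S Vs Vd
  | dirac (t : Term S Vs) : DTerm S Vs Vd
  | convex (I : Type) (p : PMF I) (hp : ∀ i, p i ≠ 0) (θ : I → DTerm S Vs Vd) : DTerm S Vs Vd
  | op {n : ℕ} (f : S.Op n) (θ : Fin n → DTerm S Vs Vd) : DTerm S Vs Vd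

/-- The product of finitely many probability distributions. -/
noncomputable def prodPMF {α : Type u} : (n : ℕ) → (Fin n → PMF α) → PMF (Fin n → α)
  | 0, _ => PMF.pure Fin.elim0
  | n + 1, π => (π 0).bind fun x => (prodPMF n (fun i => π i.succ)).map (Fin.cons x)

theorem prodPMF_apply {α : Type u} : (n : ℕ) → (π : Fin n → PMF α) → (x : Fin n → α) →
    prodPMF n π x = ∏ i, π i (x i)
  | 0, π, x => by
    have : x = Fin.elim0 := Subsingleton.elim _ _
    simp [prodPMF, this]
  | n + 1, π, x => by
    classical
    rw [prodPMF, PMF.bind_apply, tsum_eq_single (x 0), Fin.prod_univ_succ]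
    · congr 1
      rw [PMF.map_apply, tsum_eq_single (Fin.tail x), if_pos (Fin.cons_self_tail x).symm,
        prodPMF_apply n]
      · rfl
      · intro y hy
        rw [if_neg]
        rintro h
        exact hy (by rw [h, Fin.tail_cons])
    · intro y hy
      rw [PMF.map_apply]
      simp only [mul_eq_zero, ENNReal.tsum_eq_zero]
      right
      intro z
      rw [if_neg]
      intro h
      exact hy (by rw [h, Fin.cons_zero])

/-- The value of a distribution term when its state variables are replaced by the processes `σ`
and its distribution variables take the values `ρ`. In the last case this is the product
distribution, which gives mass `∏ i, πᵢ(tᵢ)` to `f(t₁,…,tₙ)` and no mass to other terms. -/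
noncomputable def DTerm.eval {S : Signature.{u}} {Vs Vd : Type} (σ : Vs → Proc S)
    (ρ : Vd → PMF (Proc S)) : DTerm S Vs Vd → PMF (Proc S)
  | .var μ => ρ μ
  | .dirac t => PMF.pure (t.subst σ)
  | .convex _ p _ θ => p.bind fun i => (θ i).eval σ ρ
  | .op (n := n) f θ => (prodPMF n (fun i => (θ i).eval σ ρ)).map (Term.op f)

/-! ### Probabilistic transition systems and bisimilarity metrics -/

/-- A probabilistic transition system with the processes over `S` as states. -/
structure PTS (S : Signature.{u}) (A : Type v) where
  trans : Proc S → A → PMF (Proc S) → Prop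

/-- `ω` is a matching for `(π, π')`: its marginals are `π` and `π'`. -/
def IsMatching {T : Type u} (π π' : PMF T) (ω : PMF (T × T)) : Prop :=
  ω.map Prod.fst = π ∧ ω.map Prod.snd = π'

/-- The Kantorovich lifting of a (1-bounded) pseudometric `d`. -/
noncomputable def kantorovich {T : Type u} (d : T → T → ℝ) (π π' : PMF T) : ℝ :=
  ⨅ ω : {ω : PMF (T × T) // IsMatching π π' ω}, ∑' x : T × T, d x.1 x.2 * (ω.1 x).toReal

/-- 1-bounded pseudometrics. -/
structure IsBoundedPseudometric {T : Type u} (d : T → T → ℝ) : Prop where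
  nonneg : ∀ s t, 0 ≤ d s t
  le_one : ∀ s t, d s t ≤ 1
  self : ∀ t, d t t = 0
  symm : ∀ s t, d s t = d t s
  triangle : ∀ s t u, d s u ≤ d s t + d t u

/-- `d` is a bisimulation metric with discount factor `lam`. -/
structure IsBisimMetric {S : Signature.{u}} {A : Type v} (M : PTS S A) (lam : ℝ)
    (d : Proc S → Proc S → ℝ) : Prop extends IsBoundedPseudometric d where
  transfer : ∀ t t', d t t' < 1 → ∀ a π, M.trans t a π →
    ∃ π', M.trans t' a π' ∧ lam * kantorovich d π π' ≤ d t t'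

/-- The bisimilarity metric with discount factor `lam`: the smallest bisimulation metric, given
as the pointwise infimum of all bisimulation metrics. -/
noncomputable def bisimDist {S : Signature.{u}} {A : Type v} (M : PTS S A) (lam : ℝ)
    (s t : Proc S) : ℝ :=
  ⨅ d : {d : Proc S → Proc S → ℝ // IsBisimMetric M lam d}, d.1 s t

/-- An operator `f` of rank `n` is uniformly continuous with respect to the distance `d`. -/
def IsUnifContOp {S : Signature.{u}} (d : Proc S → Proc S → ℝ) {n : ℕ} (f : S.Op n) : Prop :=
  ∀ ε : ℝ, 0 < ε → ∃ δ : Fin n → ℝ, (∀ i, 0 < δ i) ∧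
    ∀ s t : Fin n → Proc S, (∀ i, d (s i) (t i) < δ i) → d (.op f s) (.op f t) < ε

/-! ### PGSOS specifications -/

/-- A PGSOS rule for an operator of rank `n`, up to the names of variables, and without the
operator and the action of its conclusion. The source variables are `x_i` for `i : Fin n`. The
`k`-th positive premise is `x_i --b--> μ_k` with `(i, b) = pos k`, and `(i, b) ∈ neg` stands for
the negative premise that `x_i` has no `b`-labelled transition. -/
structure Rule (S : Signature.{u}) (A : Type v) (n : ℕ) where
  numPos : ℕ
  pos : Fin numPos → Fin n × A
  neg : List (Fin n × A)
  target : DTerm S (Fin n) (Fin numPos)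

/-- A probabilistic transition system specification over `S` and `A` in PGSOS format:
`rules f a` are the rules with source operator `f` and an `a`-labelled conclusion. -/
structure PTSS (S : Signature.{u}) (A : Type v) where
  rules : ∀ {n : ℕ}, S.Op n → A → Set (Rule S A n)
  finite_rules : ∀ {n : ℕ} (f : S.Op n) (a : A), (rules f a).Finite

/-- The instance of the rule `r` given by `σ` and `ρ` has all its premises satisfied in `M`. -/
def Rule.Premises {S : Signature.{u}} {A : Type v} {n : ℕ} (r : Rule S A n) (M : PTS S A)
    (σ : Fin n → Proc S) (ρ : Fin r.numPos → PMF (Proc S)) : Prop :=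
  (∀ k, M.trans (σ (r.pos k).1) (r.pos k).2 (ρ k)) ∧
    ∀ q ∈ r.neg, ∀ π, ¬ M.trans (σ q.1) q.2 π

/-- `M` is a supported model of `P`: its transitions are exactly those that are the conclusion of
an instance of a rule of `P` whose premises hold in `M`. -/
def PTSS.IsSupportedModel {S : Signature.{u}} {A : Type v} (P : PTSS S A) (M : PTS S A) : Prop :=
  ∀ t a π, M.trans t a π ↔ ∃ (n : ℕ) (f : S.Op n) (r : Rule S A n) (σ : Fin n → Proc S)
    (ρ : Fin r.numPos → PMF (Proc S)), r ∈ P.rules f a ∧ r.Premises M σ ρ ∧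
      t = .op f σ ∧ π = r.target.eval σ ρ

/-- The transitions derived from `P` by structural recursion on the source. -/
def PTSS.derive {S : Signature.{u}} {A : Type v} (P : PTSS S A) :
    Proc S → A → PMF (Proc S) → Prop
  | .op f ts => fun a π => ∃ r ∈ P.rules f a, ∃ ρ : Fin r.numPos → PMF (Proc S),
      (∀ k, P.derive (ts (r.pos k).1) (r.pos k).2 (ρ k)) ∧
      (∀ q ∈ r.neg, ∀ π', ¬ P.derive (ts q.1) q.2 π') ∧ π = r.target.eval ts ρ

/-- Every specification has a supported model. -/
theorem PTSS.exists_isSupportedModel {S : Signature.{u}} {A : Type v} (P : PTSS S A) :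
    ∃ M, P.IsSupportedModel M := by
  refine ⟨⟨P.derive⟩, ?_⟩
  intro t a π
  constructor
  · intro h
    match t, h with
    | .op f ts, h =>
      simp only [PTSS.derive] at h
      obtain ⟨r, hr, ρ, h1, h2, h3⟩ := h
      exact ⟨_, f, r, ts, ρ, hr, ⟨h1, h2⟩, rfl, h3⟩
  · rintro ⟨n, f, r, σ, ρ, hr, ⟨h1, h2⟩, rfl, h3⟩
    simp only [PTSS.derive]
    exact ⟨r, hr, ρ, h1, h2, h3⟩

/-- The supported model is unique. -/
theorem PTSS.isSupportedModel_unique {S : Signature.{u}} {A : Type v} (P : PTSS S A)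
    {M N : PTS S A} (hM : P.IsSupportedModel M) (hN : P.IsSupportedModel N) : M = N := by
  have key : ∀ t a π, M.trans t a π ↔ N.trans t a π := by
    intro t
    induction t with
    | var x => exact x.elim
    | op f ts ih =>
      intro a π
      rw [hM, hN]
      constructor <;>
      · rintro ⟨n, g, r, σ, ρ, hr, ⟨h1, h2⟩, h3, h4⟩
        cases h3
        refine ⟨_, _, r, _, ρ, hr, ⟨fun k => ?_, fun q hq π' h => h2 q hq π' ?_⟩, rfl, h4⟩
        · simpa [ih] using h1 k
        · simpa [ih] using h
  cases M
  cases N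
  congr
  funext t a π
  exact propext (key t a π)

/-! ### Disjoint extensions -/

/-- Translation of state terms along a map of operators. -/
def Term.mapOp {S : Signature.{u}} {S' : Signature.{w}} (ι : ∀ {n : ℕ}, S.Op n → S'.Op n)
    {V : Type} : Term S V → Term S' V
  | .var x => .var x
  | .op f ts => .op (ι f) (fun i => (ts i).mapOp ι)

/-- Translation of distribution terms along a map of operators. -/
def DTerm.mapOp {S : Signature.{u}} {S' : Signature.{w}} (ι : ∀ {n : ℕ}, S.Op n → S'.Op n)
    {Vs Vd : Type} : DTerm S Vs Vd → DTerm S' Vs Vd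
  | .var μ => .var μ
  | .dirac t => .dirac (t.mapOp ι)
  | .convex I p hp θ => .convex I p hp (fun i => (θ i).mapOp ι)
  | .op f θ => .op (ι f) (fun i => (θ i).mapOp ι)

/-- Translation of rules along a map of operators. -/
def Rule.mapOp {S : Signature.{u}} {S' : Signature.{w}} (ι : ∀ {n : ℕ}, S.Op n → S'.Op n)
    {A : Type v} {n : ℕ} (r : Rule S A n) : Rule S' A n where
  numPos := r.numPos
  pos := r.pos
  neg := r.neg
  target := r.target.mapOp ι

/-- `Q` is a disjoint extension of `P`: the operators of `P` are operators of `Q` (through the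
injection `ι`), and the rules of `Q` for these operators are exactly the rules of `P`. -/
structure DisjointExtension {S : Signature.{u}} {S' : Signature.{w}} {A : Type v}
    (P : PTSS S A) (Q : PTSS S' A) where
  ι : ∀ {n : ℕ}, S.Op n → S'.Op n
  injective : ∀ n : ℕ, Function.Injective (ι (n := n))
  rules_eq : ∀ {n : ℕ} (f : S.Op n) (a : A),
    Q.rules (ι f) a = Rule.mapOp (fun {_} g => ι g) '' P.rules f a

/-! ### The process algebra with recursive combinators -/

/-- Probabilities `p` with `0 < p < 1`. -/
abbrev Prob : Type := Set.Ioo (0 : ℝ) 1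

/-- The weights `p, 1 - p`. -/
noncomputable def Prob.weights (p : Prob) : PMF (Fin 2) :=
  PMF.ofFintype ![ENNReal.ofReal p.1, ENNReal.ofReal (1 - p.1)] (by
    have h0 := p.2.1
    have h1 := p.2.2
    rw [Fin.sum_univ_two]
    simp only [Matrix.cons_val_zero, Matrix.cons_val_one]
    rw [← ENNReal.ofReal_add h0.le (by linarith)]
    simp)

theorem Prob.weights_ne_zero (p : Prob) (i : Fin 2) : p.weights i ≠ 0 := by
  have h0 := p.2.1
  have h1 := p.2.2
  fin_cases i
  · simpa [Prob.weights] using h0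
  · simpa [Prob.weights] using h1

/-- The operators of the process algebra over the set `A` of actions, by rank. -/
inductive PAOp (A : Type v) : ℕ → Type v
  /-- the stop process `0` -/
  | nil : PAOp A 0
  /-- the skip process `ε` -/
  | skip : PAOp A 0
  /-- probabilistic action prefixing `a.([p₁]_ ⊕ … ⊕ [pₙ]_)` with positive weights -/
  | act (a : A) {n : ℕ} (p : PMF (Fin n)) (hp : ∀ i, p i ≠ 0) : PAOp A n
  /-- sequential composition `x ; y` -/
  | seq : PAOp A 2
  /-- alternative composition `x + y` -/
  | alt : PAOp A 2
  /-- probabilistic alternative composition `x +_p y` -/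
  | palt (p : Prob) : PAOp A 2
  /-- synchronous parallel composition `x | y` -/
  | sync : PAOp A 2
  /-- asynchronous parallel composition `x ||| y` -/
  | async : PAOp A 2
  /-- probabilistic parallel composition `x |||_p y` -/
  | pasync (p : Prob) : PAOp A 2
  /-- CSP-like parallel composition `x ‖_B y` -/
  | csp (B : Set A) : PAOp A 2
  /-- finite iteration `x^n` -/
  | iter (n : ℕ) : PAOp A 1
  /-- infinite iteration `x^ω` -/
  | omega : PAOp A 1
  /-- binary Kleene star `x^* y` -/
  | kleene : PAOp A 2
  /-- probabilistic Kleene star `x^{*_p} y` -/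
  | pkleene (p : Prob) : PAOp A 2
  /-- finite replication `!^n x` -/
  | repl (n : ℕ) : PAOp A 1
  /-- infinite replication (bang) `! x` -/
  | bang : PAOp A 1
  /-- probabilistic bang `!_p x` -/
  | pbang (p : Prob) : PAOp A 1

/-- The signature of the process algebra. -/
abbrev PASig (A : Type v) : Signature.{v} := ⟨PAOp A⟩

section Rules

variable {A : Type v}

/-- Application of a unary operator to a state term. -/
def t1 {V : Type} (f : PAOp A 1) (x : Term (PASig A) V) : Term (PASig A) V :=
  .op (S := PASig A) f ![x]

/-- Application of a binary operator to state terms. -/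
def t2 {V : Type} (f : PAOp A 2) (x y : Term (PASig A) V) : Term (PASig A) V :=
  .op (S := PASig A) f ![x, y]

/-- Application of a binary operator to distribution terms. -/
def d2 {Vs Vd : Type} (f : PAOp A 2) (θ η : DTerm (PASig A) Vs Vd) : DTerm (PASig A) Vs Vd :=
  .op (S := PASig A) f ![θ, η]

/-- The Dirac distribution at the stop process. -/
def dnil {Vs Vd : Type} : DTerm (PASig A) Vs Vd :=
  .dirac (.op (S := PASig A) PAOp.nil ![])

/-- The distribution term `θ ⊕_p η`. -/
noncomputable def mix {Vs Vd : Type} (p : Prob) (θ η : DTerm (PASig A) Vs Vd) :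
    DTerm (PASig A) Vs Vd :=
  .convex (Fin 2) p.weights p.weights_ne_zero ![θ, η]

/-- A rule without premises. -/
def rule0 {n : ℕ} (θ : DTerm (PASig A) (Fin n) (Fin 0)) : Rule (PASig A) A n :=
  ⟨0, ![], [], θ⟩

/-- A rule with the positive premise `x_i --b--> μ₀` and the negative premises `neg`. -/
def rule1 {n : ℕ} (i : Fin n) (b : A) (neg : List (Fin n × A))
    (θ : DTerm (PASig A) (Fin n) (Fin 1)) : Rule (PASig A) A n :=
  ⟨1, ![(i, b)], neg, θ⟩

/-- A rule with the positive premises `x_i --b--> μ₀` and `x_j --c--> μ₁`. -/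
def rule2 {n : ℕ} (i : Fin n) (b : A) (j : Fin n) (c : A)
    (θ : DTerm (PASig A) (Fin n) (Fin 2)) : Rule (PASig A) A n :=
  ⟨2, ![(i, b), (j, c)], [], θ⟩

/-- `rulesIf c r` consists of the rule `r` if the side condition `c` holds, and is empty
otherwise. -/
def rulesIf {n : ℕ} (c : Prop) (r : Rule (PASig A) A n) : Set (Rule (PASig A) A n) :=
  {r' | c ∧ r' = r}

theorem rulesIf_finite {n : ℕ} (c : Prop) (r : Rule (PASig A) A n) : (rulesIf c r).Finite :=
  (Set.finite_singleton r).subset fun _ h => h.2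

/-- The rules of the process algebra: `paRules tick f a` are the rules for the operator `f` whose
conclusion has the label `a`, where `tick` is the successful termination action. The arguments
`x, y` of `f` are the variables `0, 1`. -/
noncomputable def paRules (tick : A) : {n : ℕ} → PAOp A n → A → Set (Rule (PASig A) A n)
  | _, .nil, _ => ∅
  | _, .skip, a => rulesIf (a = tick) (rule0 dnil)
  | n, .act b p hp, a => rulesIf (a = b)
      (rule0 (.convex (Fin n) p hp (fun i => .dirac (.var i))))
  | _, .seq, a =>
      rulesIf (a ≠ tick) (rule1 0 a [] (d2 .seq (.var 0) (.dirac (.var 1))))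
      ∪ rulesIf True (rule2 0 tick 1 a (.var 1))
  | _, .alt, a =>
      rulesIf True (rule1 0 a [] (.var 0))
      ∪ rulesIf True (rule1 1 a [] (.var 0))
  | _, .palt p, a =>
      rulesIf True (rule1 0 a [(1, a)] (.var 0))
      ∪ rulesIf True (rule1 1 a [(0, a)] (.var 0))
      ∪ rulesIf True (rule2 0 a 1 a (mix p (.var 0) (.var 1)))
  | _, .sync, a =>
      rulesIf (a ≠ tick) (rule2 0 a 1 a (d2 .sync (.var 0) (.var 1)))
      ∪ rulesIf (a = tick) (rule2 0 tick 1 tick dnil)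
  | _, .async, a =>
      rulesIf (a ≠ tick) (rule1 0 a [] (d2 .async (.var 0) (.dirac (.var 1))))
      ∪ rulesIf (a ≠ tick) (rule1 1 a [] (d2 .async (.dirac (.var 0)) (.var 0)))
      ∪ rulesIf (a = tick) (rule2 0 tick 1 tick dnil)
  | _, .pasync p, a =>
      rulesIf (a ≠ tick) (rule1 0 a [(1, a)] (d2 (.pasync p) (.var 0) (.dirac (.var 1))))
      ∪ rulesIf (a ≠ tick) (rule1 1 a [(0, a)] (d2 (.pasync p) (.dirac (.var 0)) (.var 0)))
      ∪ rulesIf (a ≠ tick) (rule2 0 a 1 a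
          (mix p (d2 (.pasync p) (.var 0) (.dirac (.var 1)))
            (d2 (.pasync p) (.dirac (.var 0)) (.var 1))))
      ∪ rulesIf (a = tick) (rule2 0 tick 1 tick dnil)
  | _, .csp B, a =>
      rulesIf (a ∈ B ∧ a ≠ tick) (rule2 0 a 1 a (d2 (.csp B) (.var 0) (.var 1)))
      ∪ rulesIf (a = tick) (rule2 0 tick 1 tick dnil)
      ∪ rulesIf (a ∉ B ∧ a ≠ tick) (rule1 0 a [] (d2 (.csp B) (.var 0) (.dirac (.var 1))))
      ∪ rulesIf (a ∉ B ∧ a ≠ tick) (rule1 1 a [] (d2 (.csp B) (.dirac (.var 0)) (.var 0)))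
  | _, .iter 0, a => rulesIf (a = tick) (rule0 dnil)
  | _, .iter (n + 1), a =>
      rulesIf (a ≠ tick) (rule1 0 a [] (d2 .seq (.var 0) (.dirac (t1 (.iter n) (.var 0)))))
      ∪ rulesIf (a = tick) (rule1 0 tick [] (.var 0))
      ∪ ⋃ m : Fin (n + 1), rulesIf (a ≠ tick)
          (rule2 0 tick 0 a (d2 .seq (.var 1) (.dirac (t1 (.iter m) (.var 0)))))
  | _, .omega, a =>
      rulesIf (a ≠ tick) (rule1 0 a [] (d2 .seq (.var 0) (.dirac (t1 .omega (.var 0)))))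
  | _, .kleene, a =>
      rulesIf (a ≠ tick)
        (rule1 0 a [] (d2 .seq (.var 0) (.dirac (t2 .kleene (.var 0) (.var 1)))))
      ∪ rulesIf True (rule1 1 a [] (.var 0))
  | _, .pkleene p, a =>
      rulesIf (a ≠ tick) (rule2 0 a 1 a
        (mix p (.var 1) (d2 .seq (.var 0) (.dirac (t2 (.pkleene p) (.var 0) (.var 1))))))
      ∪ rulesIf (a ≠ tick) (rule1 0 a [(1, a)]
          (d2 .seq (.var 0) (.dirac (t2 (.pkleene p) (.var 0) (.var 1)))))
      ∪ rulesIf (a ≠ tick) (rule1 1 a [(0, a)] (.var 0))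
      ∪ rulesIf (a = tick) (rule1 1 tick [] (.var 0))
  | _, .repl 0, a => rulesIf (a = tick) (rule0 dnil)
  | _, .repl (n + 1), a =>
      rulesIf (a ≠ tick) (rule1 0 a [] (d2 .async (.var 0) (.dirac (t1 (.repl n) (.var 0)))))
      ∪ rulesIf (a = tick) (rule1 0 tick [] (.var 0))
  | _, .bang, a =>
      rulesIf (a ≠ tick) (rule1 0 a [] (d2 .async (.var 0) (.dirac (t1 .bang (.var 0)))))
  | _, .pbang p, a =>
      rulesIf (a ≠ tick) (rule1 0 a []
        (mix p (.var 0) (d2 .async (.var 0) (.dirac (t1 (.pbang p) (.var 0))))))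

theorem paRules_finite (tick : A) {n : ℕ} (f : PAOp A n) (a : A) :
    (paRules tick f a).Finite := by
  unfold paRules
  split <;> simp only [Set.finite_union, rulesIf_finite, Set.finite_empty, and_self, true_and]
  exact Set.finite_iUnion fun _ => rulesIf_finite _ _

/-- The specification of the process algebra with all non-recursive and recursive combinators. -/
noncomputable def PA (tick : A) : PTSS (PASig A) A where
  rules := fun f a => paRules tick f a
  finite_rules := fun f a => paRules_finite tick f a

end Rules

/-! ### The example processes -/

/-- The process `a.ε`. -/
noncomputable def actSkip {A : Type v} (a : A) : Proc (PASig A) :=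
  .op (S := PASig A)
    (PAOp.act a (PMF.pure (0 : Fin 1)) (fun i => by simp [Subsingleton.elim i 0]))
    ![.op (S := PASig A) PAOp.skip ![]]

/-- The process `a.([p]ε ⊕ [1 - p]0)`. -/
noncomputable def actSkipOrNil {A : Type v} (a : A) (p : Prob) : Proc (PASig A) :=
  .op (S := PASig A) (PAOp.act a p.weights p.weights_ne_zero)
    ![.op (S := PASig A) PAOp.skip ![], .op (S := PASig A) PAOp.nil ![]]

end ProbProc

/-!
The process `a.([p]ε ⊕ [1 - p]0)` is within `1 - p` of `a.ε`, but iterating it gives it in each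
round another chance `1 - p` of getting stuck at `0`, where it is at distance `1` from the
iteration of `a.ε`. So the distance `D` of the two loops satisfies `D ≥ p D + (1 - p)`, that is,
`D = 1`, however close `p` is to `1`.

For bang the deviating branch `0` is replaced by `b.0`, whose action `b` no state reached from
`!(a.0)` can match. Here the states reached in successive rounds differ, as the copies of `0` left
behind pile up; if `Dₙ` is the distance after `n` rounds, then `1 - Dₙ ≤ p (1 - Dₙ₊₁)`, hence
`1 - D₀ ≤ pⁿ` for all `n`.
-/

namespace ProbProc

universe u v w

section Distributions

variable {α : Type u} {β : Type v}

theorem map_congr_of_support {p : PMF α} {f g : α → β} (h : ∀ x ∈ p.support, f x = g x) :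
    p.map f = p.map g := by
  classical
  ext y
  simp only [PMF.map_apply]
  refine tsum_congr fun x => ?_
  by_cases hx : p x = 0
  · simp only [hx, ite_self]
  · rw [h x hx]

theorem map_apply_of_injective (p : PMF α) {f : α → β} (hf : Function.Injective f) (x : α) :
    p.map f (f x) = p x := by
  classical
  simp only [PMF.map_apply, hf.eq_iff]
  exact tsum_ite_eq' x p

theorem tsum_mul_toReal_map [Fintype α] (p : PMF α) (f : α → β) (g : β → ℝ) :
    ∑' y, g y * (p.map f y).toReal = ∑ x, g (f x) * (p x).toReal := by
  classical
  have hterm (y : β) : g y * (p.map f y).toReal =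
      ∑ x, if y = f x then g (f x) * (p x).toReal else 0 := by
    rw [PMF.map_apply, tsum_fintype,
      ENNReal.toReal_sum fun x _ => by split_ifs <;> simp [p.apply_ne_top], Finset.mul_sum]
    refine Finset.sum_congr rfl fun x _ => ?_
    split_ifs with hy <;> simp [hy]
  simp_rw [hterm]
  rw [Summable.tsum_finsetSum fun x _ => (hasSum_ite_eq (f x) _).summable]
  simp only [tsum_ite_eq]

/-- The distribution `x ⊕_p y`, with weight `p` on `x` and `1 - p` on `y`. -/
noncomputable def twoPoint (p : Prob) (x y : α) : PMF α := p.weights.map ![x, y]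

theorem map_twoPoint (p : Prob) (x y : α) (f : α → β) :
    (twoPoint p x y).map f = twoPoint p (f x) (f y) := by
  have hcomp : f ∘ ![x, y] = ![f x, f y] := funext fun i => by fin_cases i <;> rfl
  rw [twoPoint, PMF.map_comp, hcomp, twoPoint]

theorem tsum_mul_toReal_twoPoint (p : Prob) (x y : α) (g : α → ℝ) :
    ∑' z, g z * (twoPoint p x y z).toReal = p * g x + (1 - p) * g y := by
  rw [twoPoint, tsum_mul_toReal_map, Fin.sum_univ_two]
  simp [Prob.weights, p.2.1.le, p.2.2.le, mul_comm]

theorem prodPMF_two (μ ν : PMF α) :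
    prodPMF 2 ![μ, ν] = μ.bind fun x => ν.map fun y => ![x, y] := by
  have hone : prodPMF 1 ![ν] = ν.map fun y => ![y] := by
    simp only [prodPMF, PMF.pure_map]
    exact PMF.bind_pure_comp _ _
  have htail : (fun i : Fin 1 => ![μ, ν] i.succ) = ![ν] := rfl
  rw [prodPMF, htail, hone]
  simp only [PMF.map_comp]
  rfl

theorem map_prodPMF_two_pure_right (μ : PMF α) (y : α) (f : (Fin 2 → α) → β) :
    (prodPMF 2 ![μ, PMF.pure y]).map f = μ.map fun x => f ![x, y] := by
  simp only [prodPMF_two, PMF.pure_map, PMF.map_bind]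
  exact PMF.bind_pure_comp _ _

theorem map_prodPMF_two_pure_left (x : α) (ν : PMF α) (f : (Fin 2 → α) → β) :
    (prodPMF 2 ![PMF.pure x, ν]).map f = ν.map fun y => f ![x, y] := by
  rw [prodPMF_two, PMF.pure_bind, PMF.map_comp]
  rfl

end Distributions

section Kantorovich

variable {T : Type u} {π π' : PMF T} {ω : PMF (T × T)} {d : T → T → ℝ}

theorem IsMatching.swap (h : IsMatching π π' ω) : IsMatching π' π (ω.map Prod.swap) :=
  ⟨(PMF.map_comp _ _ _).trans h.2, (PMF.map_comp _ _ _).trans h.1⟩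

theorem isMatching_diagonal (π : PMF T) : IsMatching π π (π.map fun x => (x, x)) :=
  ⟨(PMF.map_comp _ _ _).trans (PMF.map_id π), (PMF.map_comp _ _ _).trans (PMF.map_id π)⟩

theorem isMatching_pure_right_iff {y : T} :
    IsMatching π (PMF.pure y) ω ↔ ω = π.map fun x => (x, y) := by
  constructor
  · intro h
    have hsnd (z : T × T) (hz : z ∈ ω.support) : z.2 = y := by
      have : z.2 ∈ (ω.map Prod.snd).support := (PMF.mem_support_map_iff _ _ _).2 ⟨z, hz, rfl⟩
      rwa [h.2, PMF.mem_support_pure_iff] at this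
    calc ω = ω.map id := (PMF.map_id ω).symm
      _ = ω.map ((fun x => (x, y)) ∘ Prod.fst) :=
        map_congr_of_support fun z hz => Prod.ext rfl (hsnd z hz)
      _ = π.map fun x => (x, y) := by rw [← PMF.map_comp, h.1]
  · rintro rfl
    exact ⟨(PMF.map_comp _ _ _).trans (PMF.map_id π),
      (PMF.map_comp _ _ _).trans (PMF.map_const π y)⟩

theorem kantorovich_pure_right (d : T → T → ℝ) (π : PMF T) (y : T) :
    kantorovich d π (PMF.pure y) = ∑' x, d x y * (π x).toReal := by
  have hinj : Function.Injective fun x : T => (x, y) := Prod.mk_left_injective y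
  have hsupp : Function.support (fun z : T × T =>
      d z.1 z.2 * ((π.map fun x => (x, y)) z).toReal) ⊆ Set.range fun x => (x, y) := by
    intro z hz
    have : z ∈ (π.map fun x => (x, y)).support := fun h0 => hz (by simp [h0])
    obtain ⟨x, -, rfl⟩ := (PMF.mem_support_map_iff _ _ _).1 this
    exact ⟨x, rfl⟩
  have : Nonempty {ω // IsMatching π (PMF.pure y) ω} := ⟨⟨_, isMatching_pure_right_iff.2 rfl⟩⟩
  refine (iInf_congr fun ω => ?_).trans ciInf_const
  rw [isMatching_pure_right_iff.1 ω.2, ← hinj.tsum_eq hsupp]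
  simp only [map_apply_of_injective π hinj]

theorem kantorovich_comm (hd : ∀ x y, d x y = d y x) (π π' : PMF T) :
    kantorovich d π π' = kantorovich d π' π := by
  have hswap (ω : PMF (T × T)) : (ω.map Prod.swap).map Prod.swap = ω := by
    rw [PMF.map_comp, Prod.swap_swap_eq, PMF.map_id]
  let e : {ω // IsMatching π π' ω} ≃ {ω // IsMatching π' π ω} :=
    { toFun := fun ω => ⟨_, ω.2.swap⟩
      invFun := fun ω => ⟨_, ω.2.swap⟩
      left_inv := fun ω => Subtype.ext (hswap ω)
      right_inv := fun ω => Subtype.ext (hswap ω) }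
  refine e.iInf_congr fun ω => ?_
  rw [← (Equiv.prodComm T T).tsum_eq]
  refine tsum_congr fun x => ?_
  rw [hd]
  exact congrArg (fun r : ENNReal => d x.1 x.2 * r.toReal)
    (map_apply_of_injective ω.1 Prod.swap_injective x)

theorem kantorovich_le_of_isMatching (hd : ∀ x y, 0 ≤ d x y) (hω : IsMatching π π' ω) :
    kantorovich d π π' ≤ ∑' z : T × T, d z.1 z.2 * (ω z).toReal := by
  refine ciInf_le (f := fun ω : {ω // IsMatching π π' ω} =>
    ∑' z : T × T, d z.1 z.2 * (ω.1 z).toReal) ⟨0, ?_⟩ ⟨ω, hω⟩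
  rintro _ ⟨ω, rfl⟩
  exact tsum_nonneg fun z => mul_nonneg (hd _ _) ENNReal.toReal_nonneg

theorem kantorovich_self_nonpos (hd : ∀ x y, 0 ≤ d x y) (hself : ∀ x, d x x = 0) (π : PMF T) :
    kantorovich d π π ≤ 0 := by
  refine (kantorovich_le_of_isMatching hd (isMatching_diagonal π)).trans_eq ?_
  refine (tsum_congr fun z => ?_).trans tsum_zero
  by_cases hz : z ∈ (π.map fun x => (x, x)).support
  · obtain ⟨x, -, rfl⟩ := (PMF.mem_support_map_iff _ _ _).1 hz
    simp only [hself, zero_mul]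
  · simp only [(PMF.apply_eq_zero_iff _ _).2 hz, ENNReal.toReal_zero, mul_zero]

theorem kantorovich_twoPoint_pure (d : T → T → ℝ) (p : Prob) (x y z : T) :
    kantorovich d (twoPoint p x y) (PMF.pure z) = p * d x z + (1 - p) * d y z := by
  rw [kantorovich_pure_right, tsum_mul_toReal_twoPoint p x y (d · z)]

end Kantorovich

section BisimulationMetrics

variable {S : Signature.{u}} {A : Type v}

open Classical in
/-- The distance with `s` and `t` at distance `c` and all other pairs of distinct points at
distance `1`, used to bound bisimilarity metrics from above; `pairDist s s c` is the discrete
metric. -/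
noncomputable def pairDist {T : Type u} (s t : T) (c : ℝ) (x y : T) : ℝ :=
  if x = y then 0 else if s(x, y) = s(s, t) then c else 1

theorem isBoundedPseudometric_pairDist {T : Type u} (s t : T) {c : ℝ} (hc : c ∈ Set.Icc 0 1) :
    IsBoundedPseudometric (pairDist s t c) := by
  obtain ⟨hc0, hc1⟩ := hc
  have hnonneg (x y : T) : 0 ≤ pairDist s t c x y := by
    unfold pairDist
    split_ifs <;> linarith
  have hle_one (x y : T) : pairDist s t c x y ≤ 1 := by
    unfold pairDist
    split_ifs <;> linarith
  have hself (x : T) : pairDist s t c x x = 0 := if_pos rfl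
  refine ⟨hnonneg, hle_one, hself, fun x y => ?_, fun x y z => ?_⟩
  · classical
    rw [pairDist, pairDist, Sym2.eq_swap]
    exact if_congr eq_comm rfl rfl
  by_cases hone : pairDist s t c x y = 1 ∨ pairDist s t c y z = 1
  · rcases hone with h | h <;> linarith [hle_one x z, hnonneg x y, hnonneg y z]
  rcases eq_or_ne x y with rfl | hxy
  · rw [hself, zero_add]
  rcases eq_or_ne y z with rfl | hyz
  · rw [hself, add_zero]
  -- Otherwise `x` and `z` are both the partner of `y` in the pair `s, t`.
  have hpair {u v : T} (huv : u ≠ v) (h : pairDist s t c u v ≠ 1) : s(u, v) = s(s, t) := by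
    by_contra hne
    exact h ((if_neg huv).trans (if_neg hne))
  rw [not_or] at hone
  obtain rfl : x = z := Sym2.congr_right.1
    (Sym2.eq_swap.trans ((hpair hxy hone.1).trans (hpair hyz hone.2).symm))
  rw [hself]
  exact add_nonneg (hnonneg _ _) (hnonneg _ _)

/-- The set of distributions reached from `t` by an `a`-transition, written `der(t, a)` in the
literature. -/
def PTS.der (M : PTS S A) (t : Proc S) (a : A) : Set (PMF (Proc S)) :=
  {π | M.trans t a π}

variable {M : PTS S A} {lam : ℝ} {s t : Proc S}

theorem isBisimMetric_pairDist (hlam : 0 ≤ lam) {c : ℝ} (hc : c ∈ Set.Icc 0 1)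
    (hst : ∀ a, ∀ π ∈ M.der s a, ∃ π' ∈ M.der t a, lam * kantorovich (pairDist s t c) π π' ≤ c)
    (hts : ∀ a, ∀ π' ∈ M.der t a, ∃ π ∈ M.der s a, lam * kantorovich (pairDist s t c) π π' ≤ c) :
    IsBisimMetric M lam (pairDist s t c) := by
  have hd := isBoundedPseudometric_pairDist s t hc
  refine ⟨hd, fun x y hlt a π hπ => ?_⟩
  by_cases hxy : x = y
  · subst hxy
    refine ⟨π, hπ, ?_⟩
    rw [hd.self]
    exact mul_nonpos_of_nonneg_of_nonpos hlam (kantorovich_self_nonpos hd.nonneg hd.self π)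
  by_cases hpair : s(x, y) = s(s, t)
  · rw [pairDist.eq_1 s t c x y, if_neg hxy, if_pos hpair]
    rcases Sym2.eq_iff.1 hpair with ⟨rfl, rfl⟩ | ⟨rfl, rfl⟩
    · exact hst a π hπ
    · obtain ⟨π', hπ', hle⟩ := hts a π hπ
      exact ⟨π', hπ', by rwa [kantorovich_comm hd.symm]⟩
  · rw [pairDist, if_neg hxy, if_neg hpair] at hlt
    exact absurd hlt (lt_irrefl 1)

theorem bisimDist_le {d : Proc S → Proc S → ℝ} (hd : IsBisimMetric M lam d) (s t : Proc S) :
    bisimDist M lam s t ≤ d s t := by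
  refine ciInf_le (f := fun d : {d : Proc S → Proc S → ℝ // IsBisimMetric M lam d} => d.1 s t)
    ⟨0, ?_⟩ ⟨d, hd⟩
  rintro _ ⟨d, rfl⟩
  exact d.2.nonneg s t

theorem isBisimMetric_pairDist_self (M : PTS S A) (hlam : 0 ≤ lam) (t : Proc S) :
    IsBisimMetric M lam (pairDist t t 0) := by
  have hd := isBoundedPseudometric_pairDist t t (c := 0) ⟨le_rfl, zero_le_one⟩
  have hrefl (π : PMF (Proc S)) : lam * kantorovich (pairDist t t 0) π π ≤ 0 :=
    mul_nonpos_of_nonneg_of_nonpos hlam (kantorovich_self_nonpos hd.nonneg hd.self π)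
  exact isBisimMetric_pairDist hlam ⟨le_rfl, zero_le_one⟩ (fun _ π hπ => ⟨π, hπ, hrefl π⟩)
    fun _ π hπ => ⟨π, hπ, hrefl π⟩

theorem le_bisimDist (hlam : 0 ≤ lam) {c : ℝ} (h : ∀ d, IsBisimMetric M lam d → c ≤ d s t) :
    c ≤ bisimDist M lam s t :=
  have : Nonempty {d : Proc S → Proc S → ℝ // IsBisimMetric M lam d} :=
    ⟨⟨_, isBisimMetric_pairDist_self M hlam s⟩⟩
  le_ciInf fun d => h d.1 d.2

theorem bisimDist_self (hlam : 0 ≤ lam) (t : Proc S) : bisimDist M lam t t = 0 :=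
  have hd := isBisimMetric_pairDist_self M hlam t
  le_antisymm ((bisimDist_le hd t t).trans_eq (hd.self t))
    (le_bisimDist hlam fun _ hd' => hd'.nonneg t t)

theorem bisimDist_eq_one (hlam : 0 ≤ lam) (h : ∀ d, IsBisimMetric M lam d → d s t = 1) :
    bisimDist M lam s t = 1 :=
  have hd := isBisimMetric_pairDist_self M hlam s
  le_antisymm ((bisimDist_le hd s t).trans (hd.le_one s t))
    (le_bisimDist hlam fun d hd' => (h d hd').ge)

theorem bisimDist_le_of_der (hlam : lam ∈ Set.Icc 0 1) {p : Prob} {x y : Proc S} {a : A}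
    (hs : ∀ c, M.der s c = {π | c = a ∧ π = twoPoint p x y})
    (ht : ∀ c, M.der t c = {π | c = a ∧ π = PMF.pure x}) :
    bisimDist M lam s t ≤ lam * (1 - p) := by
  have hp : 0 ≤ 1 - (p : ℝ) := sub_nonneg.2 p.2.2.le
  have hc : lam * (1 - p) ∈ Set.Icc (0 : ℝ) 1 :=
    ⟨mul_nonneg hlam.1 hp, mul_le_one₀ hlam.2 hp (sub_le_self 1 p.2.1.le)⟩
  set d := pairDist s t (lam * (1 - p))
  have hd : IsBoundedPseudometric d := isBoundedPseudometric_pairDist s t hc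
  have hmatch : lam * kantorovich d (twoPoint p x y) (PMF.pure x) ≤ lam * (1 - p) := by
    rw [kantorovich_twoPoint_pure, hd.self, mul_zero, zero_add]
    exact mul_le_mul_of_nonneg_left (mul_le_of_le_one_right hp (hd.le_one y x)) hlam.1
  have hbisim : IsBisimMetric M lam d := by
    refine isBisimMetric_pairDist hlam.1 hc ?_ ?_ <;>
      · simp only [hs, ht]
        rintro c _ ⟨rfl, rfl⟩
        exact ⟨_, ⟨rfl, rfl⟩, hmatch⟩
  refine (bisimDist_le hbisim s t).trans ?_
  simp only [d, pairDist]
  split_ifs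
  exacts [hc.1, le_rfl]

namespace IsBisimMetric

variable {d : Proc S → Proc S → ℝ} {a : A} {p : Prob}

theorem eq_one_of_der_eq_empty (hd : IsBisimMetric M lam d) (hs : (M.der s a).Nonempty)
    (ht : M.der t a = ∅) : d s t = 1 := by
  by_contra hne
  obtain ⟨π, hπ⟩ := hs
  obtain ⟨π', hπ', -⟩ := hd.transfer s t ((hd.le_one s t).lt_of_ne hne) a π hπ
  exact Set.eq_empty_iff_forall_notMem.1 ht π' hπ'

theorem twoPoint_le (hd : IsBisimMetric M lam d) (hlam : lam ∈ Set.Icc 0 1) {x y z : Proc S}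
    (hs : twoPoint p x y ∈ M.der s a) (ht : M.der t a = {PMF.pure z}) :
    lam * (p * d x z + (1 - p) * d y z) ≤ d s t := by
  rcases (hd.le_one s t).lt_or_eq with hlt | heq
  · obtain ⟨π, hπ, hle⟩ := hd.transfer s t hlt a _ hs
    obtain rfl : π = PMF.pure z := ht.subset hπ
    rwa [kantorovich_twoPoint_pure] at hle
  · have hp0 := p.2.1.le
    have hp1 : 0 ≤ 1 - (p : ℝ) := sub_nonneg.2 p.2.2.le
    have hnonneg := add_nonneg (mul_nonneg hp0 (hd.nonneg x z)) (mul_nonneg hp1 (hd.nonneg y z))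
    have hle : p * d x z + (1 - p) * d y z ≤ 1 := by
      linarith [mul_le_of_le_one_right hp0 (hd.le_one x z),
        mul_le_of_le_one_right hp1 (hd.le_one y z)]
    exact (mul_le_one₀ hlam.2 hnonneg hle).trans_eq heq.symm

theorem eq_one_of_chain (hd : IsBisimMetric M 1 d) {x y w : ℕ → Proc S}
    (hx : ∀ n, twoPoint p (x (n + 1)) (w n) ∈ M.der (x n) a)
    (hy : ∀ n, M.der (y n) a = {PMF.pure (y (n + 1))})
    (hw : ∀ n, d (w n) (y (n + 1)) = 1) : d (x 0) (y 0) = 1 := by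
  have hstep (n : ℕ) : 1 - d (x n) (y n) ≤ p * (1 - d (x (n + 1)) (y (n + 1))) := by
    have := hd.twoPoint_le ⟨zero_le_one, le_rfl⟩ (hx n) (hy n)
    rw [hw n] at this
    linarith
  have hpow (n : ℕ) : 1 - d (x 0) (y 0) ≤ p ^ n * (1 - d (x n) (y n)) := by
    induction n with
    | zero => simp only [pow_zero, one_mul, le_refl]
    | succ n ih =>
      rw [pow_succ, mul_assoc]
      exact ih.trans (mul_le_mul_of_nonneg_left (hstep n) (pow_nonneg p.2.1.le n))
  have hlim := tendsto_pow_atTop_nhds_zero_of_lt_one p.2.1.le p.2.2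
  have hgap : 1 - d (x 0) (y 0) ≤ 0 := ge_of_tendsto' hlim fun n =>
    (hpow n).trans (mul_le_of_le_one_right (pow_nonneg p.2.1.le n)
      (sub_le_self 1 (hd.nonneg (x n) (y n))))
  exact (hd.le_one (x 0) (y 0)).antisymm (sub_nonpos.1 hgap)

end IsBisimMetric

end BisimulationMetrics

section Rules

variable {A : Type v} {S : Signature.{w}} {M : PTS S A}

/-- The distributions that the rule `r`, applied to the arguments `ts`, allows to be reached in
`M`: the targets of its instances whose premises hold in `M`. -/
def Rule.conclusions {n : ℕ} (r : Rule S A n) (M : PTS S A) (ts : Fin n → Proc S) :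
    Set (PMF (Proc S)) :=
  {π | ∃ ρ, r.Premises M ts ρ ∧ π = r.target.eval ts ρ}

theorem PTSS.IsSupportedModel.der_op {P : PTSS S A} (hM : P.IsSupportedModel M) {n : ℕ}
    (f : S.Op n) (ts : Fin n → Proc S) (a : A) :
    M.der (.op f ts) a = ⋃ r ∈ P.rules f a, r.conclusions M ts := by
  ext π
  simp only [PTS.der, Set.mem_ofPred_eq, hM (.op f ts) a π, Set.mem_iUnion, exists_prop,
    Rule.conclusions]
  constructor
  · rintro ⟨n, g, r, σ, ρ, hr, hprem, heq, rfl⟩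
    cases heq
    exact ⟨r, hr, ρ, hprem, rfl⟩
  · rintro ⟨r, hr, ρ, hprem, rfl⟩
    exact ⟨n, f, r, ts, ρ, hr, hprem, rfl, rfl⟩

theorem biUnion_rulesIf {α : Type u} {n : ℕ} (c : Prop) (r : Rule (PASig A) A n)
    (F : Rule (PASig A) A n → Set α) : ⋃ r' ∈ rulesIf c r, F r' = {_x | c} ∩ F r := by
  ext x
  simp only [rulesIf, Set.mem_inter_iff, Set.mem_ofPred_eq, Set.mem_iUnion, exists_prop]
  constructor
  · rintro ⟨_, ⟨hc, rfl⟩, hx⟩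
    exact ⟨hc, hx⟩
  · rintro ⟨hc, hx⟩
    exact ⟨r, ⟨hc, rfl⟩, hx⟩

variable (ι : ∀ {n : ℕ}, PAOp A n → S.Op n) {n m : ℕ} (ts : Fin n → Proc S)

theorem conclusions_rule0 (M : PTS S A) (θ : DTerm (PASig A) (Fin n) (Fin 0)) :
    ((rule0 θ).mapOp (S := PASig A) ι).conclusions M ts =
      {(θ.mapOp (S := PASig A) ι).eval ts ![]} := by
  ext π
  constructor
  · rintro ⟨ρ, -, rfl⟩
    exact congrArg (DTerm.eval ts · _) (Subsingleton.elim (α := Fin 0 → PMF (Proc S)) _ _)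
  · rintro rfl
    exact ⟨![], ⟨fun k => k.elim0, fun q hq => absurd hq List.not_mem_nil⟩, rfl⟩

theorem conclusions_rule1 (i : Fin n) (b : A) (neg : List (Fin n × A))
    (θ : DTerm (PASig A) (Fin n) (Fin 1)) :
    ((rule1 i b neg θ).mapOp (S := PASig A) ι).conclusions M ts =
      {_π | ∀ q ∈ neg, M.der (ts q.1) q.2 = ∅} ∩
        (fun μ => (θ.mapOp (S := PASig A) ι).eval ts ![μ]) '' M.der (ts i) b := by
  ext π
  simp only [Set.eq_empty_iff_forall_notMem]
  constructor
  · rintro ⟨ρ, ⟨hpos, hneg⟩, rfl⟩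
    refine ⟨hneg, ρ (0 : Fin 1), hpos (0 : Fin 1), congrArg (DTerm.eval ts · _) ?_⟩
    exact funext fun k => by fin_cases k; rfl
  · rintro ⟨hneg, μ, hμ, rfl⟩
    refine ⟨![μ], ⟨fun k => ?_, hneg⟩, rfl⟩
    obtain rfl : k = (0 : Fin 1) := Subsingleton.elim (α := Fin 1) _ _
    exact hμ

theorem conclusions_rule2 (i : Fin n) (b : A) (j : Fin n) (c : A)
    (θ : DTerm (PASig A) (Fin n) (Fin 2)) :
    ((rule2 i b j c θ).mapOp (S := PASig A) ι).conclusions M ts =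
      Set.image2 (fun μ ν => (θ.mapOp (S := PASig A) ι).eval ts ![μ, ν])
        (M.der (ts i) b) (M.der (ts j) c) := by
  ext π
  constructor
  · rintro ⟨ρ, ⟨hpos, -⟩, rfl⟩
    refine ⟨ρ (0 : Fin 2), hpos (0 : Fin 2), ρ (1 : Fin 2), hpos (1 : Fin 2),
      congrArg (DTerm.eval ts · _) ?_⟩
    exact funext fun k => by fin_cases k <;> rfl
  · rintro ⟨μ, hμ, ν, hν, rfl⟩
    refine ⟨![μ, ν], ⟨fun k => ?_, fun q hq => absurd hq List.not_mem_nil⟩, rfl⟩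
    change Fin 2 at k
    fin_cases k
    exacts [hμ, hν]

theorem eval_mapOp_d2_dirac_right (f : PAOp A 2) (θ : DTerm (PASig A) (Fin n) (Fin m))
    (t : Term (PASig A) (Fin n)) (ρ : Fin m → PMF (Proc S)) :
    ((d2 f θ (.dirac t)).mapOp (S := PASig A) ι).eval ts ρ =
      ((θ.mapOp (S := PASig A) ι).eval ts ρ).map fun x =>
        .op (ι f) ![x, (t.mapOp (S := PASig A) ι).subst ts] :=
  map_prodPMF_two_pure_right _ _ _

theorem eval_mapOp_d2_dirac_left (f : PAOp A 2) (θ : DTerm (PASig A) (Fin n) (Fin m))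
    (t : Term (PASig A) (Fin n)) (ρ : Fin m → PMF (Proc S)) :
    ((d2 f (.dirac t) θ).mapOp (S := PASig A) ι).eval ts ρ =
      ((θ.mapOp (S := PASig A) ι).eval ts ρ).map fun x =>
        .op (ι f) ![(t.mapOp (S := PASig A) ι).subst ts, x] :=
  map_prodPMF_two_pure_left _ _ _

theorem subst_mapOp_t1 (f : PAOp A 1) (x : Term (PASig A) (Fin n)) :
    ((t1 f x).mapOp (S := PASig A) ι).subst ts =
      .op (ι f) ![(x.mapOp (S := PASig A) ι).subst ts] :=
  congrArg (Term.op (ι f)) (funext fun i => by fin_cases i; rfl)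

theorem subst_mapOp_t2 (f : PAOp A 2) (x y : Term (PASig A) (Fin n)) :
    ((t2 f x y).mapOp (S := PASig A) ι).subst ts =
      .op (ι f) ![(x.mapOp (S := PASig A) ι).subst ts, (y.mapOp (S := PASig A) ι).subst ts] :=
  congrArg (Term.op (ι f)) (funext fun i => by fin_cases i <;> rfl)

end Rules

namespace DisjointExtension

variable {A : Type v} {S : Signature.{w}} {tick : A} {P : PTSS S A} {M : PTS S A}
  (E : DisjointExtension (PA tick) P)

theorem der_op (hM : P.IsSupportedModel M) {n : ℕ} (f : PAOp A n) (ts : Fin n → Proc S) (a : A) :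
    M.der (.op (E.ι f) ts) a =
      ⋃ r ∈ paRules tick f a, (r.mapOp (S := PASig A) E.ι).conclusions M ts := by
  rw [hM.der_op, E.rules_eq, Set.biUnion_image]
  rfl

/-- The stop process `0` of the extension. -/
def nil : Proc S := .op (E.ι .nil) ![]

/-- The skip process `ε` of the extension. -/
def skip : Proc S := .op (E.ι .skip) ![]

/-- The process `a.x` of the extension, with the prefix operator of `actSkip`. -/
noncomputable def act (a : A) (x : Proc S) : Proc S :=
  .op (E.ι (.act a (PMF.pure (0 : Fin 1)) fun i => by simp [Subsingleton.elim i 0])) ![x]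

/-- The process `a.([p]x ⊕ [1 - p]y)` of the extension. -/
noncomputable def probAct (a : A) (p : Prob) (x y : Proc S) : Proc S :=
  .op (E.ι (.act a p.weights p.weights_ne_zero)) ![x, y]

/-- The process `x ; y` of the extension. -/
def seq (x y : Proc S) : Proc S := .op (E.ι .seq) ![x, y]

/-- The process `x ||| y` of the extension. -/
def async (x y : Proc S) : Proc S := .op (E.ι .async) ![x, y]

/-- The process `!x` of the extension. -/
def bang (x : Proc S) : Proc S := .op (E.ι .bang) ![x]

theorem actSkip_mapOp (a : A) : (actSkip a).mapOp (S := PASig A) E.ι = E.act a E.skip := by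
  refine congrArg (Term.op _) (funext fun i => ?_)
  fin_cases i
  exact congrArg (Term.op (E.ι PAOp.skip)) (Subsingleton.elim _ _)

theorem actSkipOrNil_mapOp (a : A) (p : Prob) :
    (actSkipOrNil a p).mapOp (S := PASig A) E.ι = E.probAct a p E.skip E.nil := by
  refine congrArg (Term.op _) (funext fun i => ?_)
  fin_cases i
  · exact congrArg (Term.op (E.ι PAOp.skip)) (Subsingleton.elim _ _)
  · exact congrArg (Term.op (E.ι PAOp.nil)) (Subsingleton.elim _ _)

section Derivatives

variable (hM : P.IsSupportedModel M)
include hM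

theorem der_nil (a : A) : M.der E.nil a = ∅ := by
  rw [nil, E.der_op hM]
  exact Set.biUnion_empty _

theorem der_skip (a : A) : M.der E.skip a = {π | a = tick ∧ π = PMF.pure E.nil} := by
  have heval : (DTerm.mapOp (S := PASig A) E.ι (dnil (Vs := Fin 0) (Vd := Fin 0))).eval ![] ![] =
      PMF.pure E.nil :=
    congrArg (fun ts => PMF.pure (Term.op (E.ι PAOp.nil) ts)) (Subsingleton.elim _ _)
  rw [skip, E.der_op hM, paRules, biUnion_rulesIf, conclusions_rule0, heval]
  rfl

theorem der_op_act {n : ℕ} (b : A) (p : PMF (Fin n)) (hp : ∀ i, p i ≠ 0) (ts : Fin n → Proc S)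
    (a : A) : M.der (.op (E.ι (.act b p hp)) ts) a = {π | a = b ∧ π = p.map ts} := by
  rw [E.der_op hM, paRules, biUnion_rulesIf, conclusions_rule0]
  rfl

theorem der_act (b : A) (x : Proc S) (a : A) :
    M.der (E.act b x) a = {π | a = b ∧ π = PMF.pure x} := by
  rw [act, E.der_op_act hM, PMF.pure_map]
  rfl

theorem der_probAct (b : A) (p : Prob) (x y : Proc S) (a : A) :
    M.der (E.probAct b p x y) a = {π | a = b ∧ π = twoPoint p x y} :=
  E.der_op_act hM b _ _ _ a

variable {a : A} (ha : a ≠ tick)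
include ha

theorem der_seq (x y : Proc S) : M.der (E.seq x y) a =
    PMF.map (E.seq · y) '' M.der x a ∪ Set.image2 (fun _ ν => ν) (M.der x tick) (M.der y a) := by
  simp only [seq, E.der_op hM, paRules, Set.biUnion_union, biUnion_rulesIf, conclusions_rule1,
    conclusions_rule2, eval_mapOp_d2_dirac_right]
  simp [DTerm.mapOp, DTerm.eval, ha, Term.mapOp, Term.subst]

theorem der_async (x y : Proc S) : M.der (E.async x y) a =
    PMF.map (E.async · y) '' M.der x a ∪ PMF.map (E.async x ·) '' M.der y a := by
  simp only [async, E.der_op hM, paRules, Set.biUnion_union, biUnion_rulesIf, conclusions_rule1,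
    eval_mapOp_d2_dirac_right, eval_mapOp_d2_dirac_left]
  simp [DTerm.mapOp, DTerm.eval, ha, Term.mapOp, Term.subst]

theorem der_bang (x : Proc S) :
    M.der (E.bang x) a = PMF.map (E.async · (E.bang x)) '' M.der x a := by
  simp only [bang, async, E.der_op hM, paRules, biUnion_rulesIf, conclusions_rule1,
    eval_mapOp_d2_dirac_right, subst_mapOp_t1]
  simp [DTerm.mapOp, DTerm.eval, ha, Term.mapOp, Term.subst]

theorem der_omega (x : Proc S) : M.der (.op (E.ι .omega) ![x]) a =
    PMF.map (E.seq · (.op (E.ι .omega) ![x])) '' M.der x a := by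
  simp only [seq, E.der_op hM, paRules, biUnion_rulesIf, conclusions_rule1,
    eval_mapOp_d2_dirac_right, subst_mapOp_t1]
  simp [DTerm.mapOp, DTerm.eval, ha, Term.mapOp, Term.subst]

theorem der_kleene (x y : Proc S) : M.der (.op (E.ι .kleene) ![x, y]) a =
    PMF.map (E.seq · (.op (E.ι .kleene) ![x, y])) '' M.der x a ∪ M.der y a := by
  simp only [seq, E.der_op hM, paRules, Set.biUnion_union, biUnion_rulesIf, conclusions_rule1,
    eval_mapOp_d2_dirac_right, subst_mapOp_t2]
  simp [DTerm.mapOp, DTerm.eval, ha, Term.mapOp, Term.subst]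

theorem der_pkleene_of_der_eq_empty (p : Prob) (x : Proc S) {y : Proc S} (hy : M.der y a = ∅) :
    M.der (.op (E.ι (.pkleene p)) ![x, y]) a =
      PMF.map (E.seq · (.op (E.ι (.pkleene p)) ![x, y])) '' M.der x a := by
  simp only [seq, E.der_op hM, paRules, Set.biUnion_union, biUnion_rulesIf, conclusions_rule1,
    conclusions_rule2, eval_mapOp_d2_dirac_right, subst_mapOp_t2]
  simp [DTerm.mapOp, DTerm.eval, ha, Term.mapOp, Term.subst, hy]

end Derivatives

section Distances

/-- As far as `a`-transitions are concerned, `u` iterates `x`: it behaves like `x ; u`, provided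
that `x` does not terminate immediately. -/
def IsLoop (M : PTS S A) (a : A) (x u : Proc S) : Prop :=
  M.der u a = PMF.map (E.seq · u) '' M.der x a

variable (hM : P.IsSupportedModel M)
include hM

theorem bisimDist_probAct_act_le {lam : ℝ} (hlam : lam ∈ Set.Icc 0 1) (a : A) (p : Prob)
    (x y : Proc S) : bisimDist M lam (E.probAct a p x y) (E.act a x) ≤ lam * (1 - p) :=
  bisimDist_le_of_der hlam (E.der_probAct hM a p x y) (E.der_act hM a x)

theorem bisimDist_probAct_skip_nil_act_skip {lam : ℝ} (hlam : lam ∈ Set.Icc 0 1) (a : A)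
    (p : Prob) :
    bisimDist M lam (E.probAct a p E.skip E.nil) (E.act a E.skip) = lam * (1 - p) := by
  refine (E.bisimDist_probAct_act_le hM hlam a p _ _).antisymm (le_bisimDist hlam.1 fun d hd => ?_)
  have hskip : (M.der E.skip tick).Nonempty := ⟨_, (E.der_skip hM tick).superset ⟨rfl, rfl⟩⟩
  have hnil : d E.nil E.skip = 1 := by
    rw [hd.symm, hd.eq_one_of_der_eq_empty hskip (E.der_nil hM tick)]
  have hact : M.der (E.act a E.skip) a = {PMF.pure E.skip} := by
    simp only [E.der_act hM, true_and, Set.ofPred_eq_eq_singleton]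
  have hle := hd.twoPoint_le hlam ((E.der_probAct hM a p E.skip E.nil a).superset ⟨rfl, rfl⟩) hact
  rwa [hd.self, hnil, mul_zero, zero_add, mul_one] at hle

variable {a : A}

theorem not_isUnifContOp_of_bisimDist_eq_one {n : ℕ} {f : S.Op (n + 1)} {ts : Fin n → Proc S}
    {x y : Proc S} (h : ∀ p : Prob,
      bisimDist M 1 (.op f (Matrix.vecCons (E.probAct a p x y) ts))
        (.op f (Matrix.vecCons (E.act a x) ts)) = 1) :
    ¬ IsUnifContOp (bisimDist M 1) f := by
  intro hf
  obtain ⟨δ, hδ, hclose⟩ := hf 1 one_pos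
  obtain ⟨p, hp, hp1⟩ := exists_between (max_lt one_pos (sub_lt_self 1 (hδ 0)))
  rw [max_lt_iff] at hp
  refine (hclose _ _ (Fin.cases ?_ fun i => ?_)).ne (h ⟨p, hp.1, hp1⟩)
  · refine (E.bisimDist_probAct_act_le hM ⟨zero_le_one, le_rfl⟩ a _ x y).trans_lt ?_
    rw [one_mul]
    exact sub_lt_comm.1 hp.2
  · exact (bisimDist_self zero_le_one (ts i)).trans_lt (hδ i.succ)

variable (ha : a ≠ tick)
include ha

theorem isLoop_omega (x : Proc S) : E.IsLoop M a x (.op (E.ι .omega) ![x]) :=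
  E.der_omega hM ha x

theorem isLoop_kleene_nil (x : Proc S) : E.IsLoop M a x (.op (E.ι .kleene) ![x, E.nil]) := by
  rw [IsLoop, E.der_kleene hM ha, E.der_nil hM, Set.union_empty]

theorem isLoop_pkleene_nil (p : Prob) (x : Proc S) :
    E.IsLoop M a x (.op (E.ι (.pkleene p)) ![x, E.nil]) :=
  E.der_pkleene_of_der_eq_empty hM ha p x (E.der_nil hM a)

theorem der_seq_skip (x : Proc S) : M.der (E.seq E.skip x) a = M.der x a := by
  rw [E.der_seq hM ha]
  simp [E.der_skip hM, ha]

theorem der_seq_nil (x : Proc S) : M.der (E.seq E.nil x) a = ∅ := by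
  rw [E.der_seq hM ha]
  simp [E.der_nil hM]

theorem bisimDist_eq_one_of_isLoop {p : Prob} {u v : Proc S}
    (hu : E.IsLoop M a (E.probAct a p E.skip E.nil) u) (hv : E.IsLoop M a (E.act a E.skip) v) :
    bisimDist M 1 u v = 1 := by
  have hder_u : M.der u a = {twoPoint p (E.seq E.skip u) (E.seq E.nil u)} := by
    rw [hu]
    simp [E.der_probAct hM, map_twoPoint]
  have hder_v : M.der v a = {PMF.pure (E.seq E.skip v)} := by
    rw [hv]
    simp [E.der_act hM, PMF.pure_map]
  refine bisimDist_eq_one zero_le_one fun d hd => ?_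
  have hstuck : d (E.seq E.nil u) (E.seq E.skip v) = 1 := by
    rw [hd.symm]
    refine hd.eq_one_of_der_eq_empty ?_ (E.der_seq_nil hM ha u)
    rw [E.der_seq_skip hM ha, hder_v]
    exact Set.singleton_nonempty _
  -- After the first round the two loops stay at `ε ; u` and `ε ; v`.
  refine hd.eq_one_of_chain (a := a) (p := p) (w := fun _ => E.seq E.nil u)
    (x := fun n => n.casesOn u fun _ => E.seq E.skip u)
    (y := fun n => n.casesOn v fun _ => E.seq E.skip v) ?_ ?_ fun _ => hstuck
  · rintro (_ | n)
    · exact hder_u.superset rfl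
    · exact ((E.der_seq_skip hM ha u).trans hder_u).superset rfl
  · rintro (_ | n)
    · exact hder_v
    · exact (E.der_seq_skip hM ha v).trans hder_v

theorem der_iterate_async_nil (n : ℕ) (x : Proc S) :
    M.der ((E.async E.nil)^[n] x) a = PMF.map (E.async E.nil)^[n] '' M.der x a := by
  induction n with
  | zero => simp [Function.iterate_zero, PMF.map_id]
  | succ n ih =>
    have hcomp : PMF.map (E.async E.nil)^[n + 1] =
        PMF.map (E.async E.nil) ∘ PMF.map (E.async E.nil)^[n] := by
      rw [Function.iterate_succ']
      exact funext fun π => (PMF.map_comp _ π _).symm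
    rw [Function.iterate_succ_apply', E.der_async hM ha, E.der_nil hM, ih, Set.image_empty,
      Set.empty_union, hcomp, Set.image_comp]

theorem bisimDist_bang_eq_one {b : A} (hb : b ≠ tick) (hba : b ≠ a) (p : Prob) :
    bisimDist M 1 (E.bang (E.probAct a p E.nil (E.act b E.nil))) (E.bang (E.act a E.nil)) = 1 := by
  set s := E.probAct a p E.nil (E.act b E.nil)
  set t := E.act a E.nil
  refine bisimDist_eq_one zero_le_one fun d hd => ?_
  -- A copy that took its `a`-step to `0` is left behind, so the states of round `n` are padded
  -- with `n` copies of `0`.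
  refine hd.eq_one_of_chain (a := a) (p := p) (x := fun n => (E.async E.nil)^[n] (E.bang s))
    (y := fun n => (E.async E.nil)^[n] (E.bang t))
    (w := fun n => (E.async E.nil)^[n] (E.async (E.act b E.nil) (E.bang s)))
    (fun n => ?_) (fun n => ?_) fun n => ?_
  · simp [E.der_iterate_async_nil hM ha, E.der_bang hM ha, s, E.der_probAct hM, map_twoPoint]
  · simp [E.der_iterate_async_nil hM ha, E.der_bang hM ha, t, E.der_act hM, PMF.pure_map]
  · have hbang : M.der (E.bang t) b = ∅ := by
      simp [E.der_bang hM hb, t, E.der_act hM, hba]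
    refine hd.eq_one_of_der_eq_empty (a := b) ?_ ?_
    · simp [E.der_iterate_async_nil hM hb, E.der_async hM hb, E.der_act hM]
    · rw [E.der_iterate_async_nil hM hb, hbang, Set.image_empty]

end Distances

end DisjointExtension

end ProbProc

/-- Let `P` be any disjoint extension of the process algebra, with supported model `M`, and let `d`
be its non-discounted bisimilarity metric. None of infinite iteration, Kleene star, probabilistic
Kleene star and bang is uniformly continuous with respect to `d`. There has to be an action `a`
other than the termination action `tick`, and for bang a second one. -/
theorem mainTheorem9 {A : Type*} (tick : A) {S : ProbProc.Signature}
    (P : ProbProc.PTSS S A)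
    (E : ProbProc.DisjointExtension (ProbProc.PA tick) P)
    (M : ProbProc.PTS S A) (hM : P.IsSupportedModel M)
    (a : A) (ha : a ≠ tick) :
    ¬ ProbProc.IsUnifContOp (ProbProc.bisimDist M 1) (E.ι ProbProc.PAOp.omega) ∧
    ¬ ProbProc.IsUnifContOp (ProbProc.bisimDist M 1) (E.ι ProbProc.PAOp.kleene) ∧
    (∀ p : ProbProc.Prob,
      ¬ ProbProc.IsUnifContOp (ProbProc.bisimDist M 1) (E.ι (ProbProc.PAOp.pkleene p))) ∧
    ((∃ b : A, b ≠ tick ∧ b ≠ a) →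
      ¬ ProbProc.IsUnifContOp (ProbProc.bisimDist M 1) (E.ι ProbProc.PAOp.bang)) ∧
    ∀ (δ : ℝ) (h0 : 0 < δ) (h2 : δ < 2) (s t : ProbProc.Proc S),
      s = (ProbProc.actSkipOrNil a
        ⟨1 - δ / 2, by linarith, by linarith⟩).mapOp (fun {_} f => E.ι f) →
      t = (ProbProc.actSkip a).mapOp (fun {_} f => E.ι f) →
      ProbProc.bisimDist M 1 s t = δ / 2 ∧
      ProbProc.bisimDist M 1 (.op (E.ι ProbProc.PAOp.omega) ![s])
        (.op (E.ι ProbProc.PAOp.omega) ![t]) = 1 := by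
  refine ⟨?omega, ?kleene, fun q => ?pkleene, ?bang, ?distances⟩
  case omega =>
    exact E.not_isUnifContOp_of_bisimDist_eq_one hM fun p =>
      E.bisimDist_eq_one_of_isLoop hM ha (p := p) (E.isLoop_omega hM ha _) (E.isLoop_omega hM ha _)
  case kleene =>
    exact E.not_isUnifContOp_of_bisimDist_eq_one hM fun p =>
      E.bisimDist_eq_one_of_isLoop hM ha (p := p)
        (E.isLoop_kleene_nil hM ha _) (E.isLoop_kleene_nil hM ha _)
  case pkleene =>
    exact E.not_isUnifContOp_of_bisimDist_eq_one hM fun p =>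
      E.bisimDist_eq_one_of_isLoop hM ha (p := p)
        (E.isLoop_pkleene_nil hM ha q _) (E.isLoop_pkleene_nil hM ha q _)
  case bang =>
    rintro ⟨b, hb, hba⟩
    exact E.not_isUnifContOp_of_bisimDist_eq_one hM (E.bisimDist_bang_eq_one hM ha hb hba)
  case distances =>
    rintro δ - - _ _ rfl rfl
    rw [E.actSkipOrNil_mapOp, E.actSkip_mapOp]
    refine ⟨?_, E.bisimDist_eq_one_of_isLoop hM ha (E.isLoop_omega hM ha _)
      (E.isLoop_omega hM ha _)⟩
    rw [E.bisimDist_probAct_skip_nil_act_skip hM ⟨zero_le_one, le_rfl⟩, one_mul, sub_sub_cancel]
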